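/- Graphs are finite and undirected; loops and parallel edges are allowed. For a graph $G$ put $\Delta(G)=|E(G)|-|V(G)|$. Let $S(x,G)$ be the set of edges (including loops) incident to the vertex $x$, let $\mathcal{S}(G)=\{S(x,G): x\in V(G)\}$, and let $G\setminus x$ be the graph obtained from $G$ by deleting $x$ together with all edges incident to it. A graph is a cacti-graph if it has no isolated vertices, no leaves (vertices of degree $1$, where a loop contributes $2$ to the degree) and no connected component that is a cycle (a loop and a pair of parallel edges being cycles of length $1$ and $2$); a cactus is a connected cacti-graph. For $C\subseteq E(G)$ let $G\langle C\rangle$ be the subgraph formed by the edges of $C$ and their ends. The bicircular matroid $M_1(G)$ is the matroid on $E(G)$ whose circuits are the sets $C\subseteq E(G)$ such that $\Delta(G\langle C\rangle)=1$ and $G\langle C\rangle$ is a cacti-graph. Graphs $G$ and $G'$ are strongly isomorphic if $E(G)=E(G')$ and there is a bijection $\nu:V(G)\to V(G')$ such that, for every edge $e$ and all $x,y\in V(G)$, $e$ has ends $x,y$ in $G$ if and only if $e$ has ends $\nu(x),\nu(y)$ in $G'$. **Theorem.** Let $G$ and $G'$ be finite graphs, where $G'$ has no isolated vertices. Suppose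 that (a1) $\Delta(G)\ge 1$ and $G$ is a cactus, (a2) for every vertex $x$ of $G$, $\Delta(G\setminus x)\ge 1$ and $G\setminus x$ is a cactus, and (a3) $M_1(G')=M_1(G)$. Then $\mathcal{S}(G)=\mathcal{S}(G')$, and $G$ and $G'$ are strongly isomorphic. -/

import Mathlib

open scoped Graph

namespace KCircular

/-! Graphs are Mathlib's multigraphs `Graph α β` (vertices in `α`, edges in `β`, loops and parallel
edges allowed), with vertex set `V(G)` and edge set `E(G)`. -/

/-- `G` is a finite graph. -/
def IsFiniteGraph {α β : Type*} (G : Graph α β) : Prop :=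
  V(G).Finite ∧ E(G).Finite

/-- `Δ(G) = |E(G)| - |V(G)|`, an integer (used for finite graphs only). -/
noncomputable def excess {α β : Type*} (G : Graph α β) : ℤ :=
  (E(G).ncard : ℤ) - (V(G).ncard : ℤ)

/-- The vertex star `S(x, G)`: the set of all edges (loops included) incident to `x`. -/
def star {α β : Type*} (G : Graph α β) (x : α) : Set β :=
  G.incidenceSet x

/-- The set `𝒮(G)` of all vertex stars of `G`. -/
def vertexStars {α β : Type*} (G : Graph α β) : Set (Set β) :=
  {S | ∃ x ∈ V(G), S = star G x}

/-- The degree of a vertex; a loop is counted twice. -/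
noncomputable def degree {α β : Type*} (G : Graph α β) (x : α) : ℕ :=
  (G.incidenceSet x).ncard + (G.loopSet x).ncard

/-- `G` has no isolated vertices. -/
def NoIsolatedVertices {α β : Type*} (G : Graph α β) : Prop :=
  ∀ x ∈ V(G), ∃ e, G.Inc e x

/-- `G` has no leaves, that is, no vertices of degree one. -/
def NoLeaves {α β : Type*} (G : Graph α β) : Prop :=
  ∀ x ∈ V(G), degree G x ≠ 1

/-- A graph is connected if it has a vertex and any two vertices are joined by a walk. -/
def IsConnected {α β : Type*} (G : Graph α β) : Prop :=
  V(G).Nonempty ∧ ∀ x ∈ V(G), ∀ y ∈ V(G), Relation.ReflTransGen G.Adj x y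

/-- `H` is a (connected) component of `G`. Here `H ≤c G` means that `H` is a subgraph of `G` which
contains every edge of `G` having an end in `H`. -/
def IsComponent {α β : Type*} (H G : Graph α β) : Prop :=
  H.IsClosedSubgraph G ∧ IsConnected H

/-- A cycle is a finite connected graph in which all degrees are two (a vertex with a loop and a
pair of parallel edges are cycles of length one and two). -/
def IsCycleGraph {α β : Type*} (H : Graph α β) : Prop :=
  IsFiniteGraph H ∧ IsConnected H ∧ ∀ x ∈ V(H), degree H x = 2

/-- Cacti-graphs: no isolated vertices, no leaves and no components that are cycles. -/
def IsCactiGraph {α β : Type*} (G : Graph α β) : Prop :=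
  NoIsolatedVertices G ∧ NoLeaves G ∧ ∀ H : Graph α β, IsComponent H G → ¬ IsCycleGraph H

/-- A cactus is a connected cacti-graph. -/
def IsCactus {α β : Type*} (G : Graph α β) : Prop :=
  IsConnected G ∧ IsCactiGraph G

/-- The subgraph `G⟨X⟩` of `G` induced by a set `X` of edges: its edges are those of `X` and its
vertices are the ends of these edges. -/
def edgeInduced {α β : Type*} (G : Graph α β) (X : Set β) : Graph α β where
  vertexSet := {x | ∃ e ∈ X, G.Inc e x}
  edgeSet := E(G) ∩ X
  IsLink e x y := e ∈ X ∧ G.IsLink e x y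
  isLink_symm _ _ := { symm _ _ h := ⟨h.1, h.2.symm⟩ }
  eq_or_eq_of_isLink_of_isLink _ _ _ _ _ h h' := h.2.left_eq_or_eq h'.2
  edge_mem_iff_exists_isLink e :=
    ⟨fun h ↦ by
      obtain ⟨x, y, hxy⟩ := G.exists_isLink_of_mem_edgeSet h.1
      exact ⟨x, y, h.2, hxy⟩, fun ⟨_, _, h⟩ ↦ ⟨h.2.edge_mem, h.1⟩⟩
  left_mem_of_isLink e _ _ h := ⟨e, h.1, h.2.inc_left⟩

/-- The family `𝒞_k(G)` of all (finite) edge sets `C` of `G` such that `Δ(G⟨C⟩) = k` and `G⟨C⟩` is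
a cacti-graph. -/
def circuits {α β : Type*} (G : Graph α β) (k : ℕ) : Set (Set β) :=
  {C | C ⊆ E(G) ∧ C.Finite ∧ excess (edgeInduced G C) = k ∧ IsCactiGraph (edgeInduced G C)}

/-- Two graphs are strongly isomorphic if they have the same edge set and there is a bijection `ν`
of their vertex sets such that `e` has ends `x, y` in the first graph if and only if it has ends
`ν x, ν y` in the second. -/
def StronglyIsomorphic {α α' β : Type*} (G : Graph α β) (G' : Graph α' β) : Prop :=
  E(G) = E(G') ∧ ∃ ν : V(G) ≃ V(G'), ∀ (e : β) (x y : V(G)),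
    G.IsLink e x y ↔ G'.IsLink e (ν x) (ν y)

/-! ### The family `circuits G k` is the family of circuits of a matroid -/

theorem edgeInduced_inc {α β : Type*} {G : Graph α β} {X : Set β} {e : β} {x : α} :
    (edgeInduced G X).Inc e x ↔ e ∈ X ∧ G.Inc e x := by
  simp [Graph.Inc, edgeInduced]

theorem edgeInduced_isLoopAt {α β : Type*} {G : Graph α β} {X : Set β} {e : β} {x : α} :
    (edgeInduced G X).IsLoopAt e x ↔ e ∈ X ∧ G.IsLoopAt e x := Iff.rfl

theorem finite_ends {α β : Type*} (G : Graph α β) (e : β) : {x | G.Inc e x}.Finite := by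
  by_cases h : e ∈ E(G)
  · obtain ⟨a, b, hab⟩ := G.exists_isLink_of_mem_edgeSet h
    refine (Set.toFinite {a, b}).subset fun x hx ↦ ?_
    simpa using hx.eq_or_eq_of_isLink hab
  · simp [h]

theorem finite_vertexSet {α β : Type*} (G : Graph α β) (X : Finset β) :
    V(edgeInduced G (X : Set β)).Finite := by
  have : V(edgeInduced G (X : Set β)) = ⋃ e ∈ (X : Set β), {x | G.Inc e x} := by
    ext x; simp [edgeInduced]
  rw [this]
  exact X.finite_toSet.biUnion fun e _ ↦ finite_ends G e

/-- The set of vertices of `G⟨X⟩`, as a finset. -/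
noncomputable def ends {α β : Type*} (G : Graph α β) (X : Finset β) : Finset α :=
  (finite_vertexSet G X).toFinset

theorem mem_ends {α β : Type*} {G : Graph α β} {X : Finset β} {x : α} :
    x ∈ ends G X ↔ ∃ e ∈ X, G.Inc e x := by
  simp [ends, edgeInduced]

theorem excess_edgeInduced {α β : Type*} {G : Graph α β} {X : Finset β} (h : (X : Set β) ⊆ E(G)) :
    excess (edgeInduced G (X : Set β)) = (X.card : ℤ) - (ends G X).card := by
  have h1 : E(edgeInduced G (X : Set β)) = (X : Set β) := Set.inter_eq_right.2 h
  have h2 : V(edgeInduced G (X : Set β)) = (ends G X : Set α) := by simp [ends]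
  rw [excess, h1, h2, Set.ncard_coe_finset, Set.ncard_coe_finset]

open Classical in
/-- The number of ends of the edge `e` in `W`; a loop has two equal ends. -/
noncomputable def endCount {α β : Type*} (G : Graph α β) (W : Finset α) (e : β) : ℕ :=
  {w ∈ W | G.Inc e w}.card + {w ∈ W | G.IsLoopAt e w}.card

open Classical in
theorem endCount_le {α β : Type*} (G : Graph α β) (W : Finset α) (e : β) :
    endCount G W e ≤ 2 ∧ (endCount G W e = 2 → ∀ x, G.Inc e x → x ∈ W) ∧
      (e ∈ E(G) → (∀ x, G.Inc e x → x ∈ W) → endCount G W e = 2) := by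
  by_cases he : e ∈ E(G)
  swap
  · have h1 : ∀ x, ¬ G.Inc e x := fun x hx ↦ he hx.edge_mem
    have h2 : ∀ x, ¬ G.IsLoopAt e x := fun x hx ↦ he hx.edge_mem
    simp [endCount, h2, he]
  obtain ⟨a, b, hab⟩ := G.exists_isLink_of_mem_edgeSet he
  have hinc : ∀ x, G.Inc e x ↔ x = a ∨ x = b := fun x ↦
    ⟨fun h ↦ h.eq_or_eq_of_isLink hab, by
      rintro (rfl | rfl)
      exacts [hab.inc_left, hab.inc_right]⟩
  have hloop : ∀ x, G.IsLoopAt e x ↔ a = x ∧ b = x := fun x ↦ by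
    rw [← Graph.isLink_self_iff, hab.isLink_iff]
    tauto
  have hflt : ∀ c, {w ∈ W | w = c} = if c ∈ W then {c} else ∅ := fun c ↦ by
    split_ifs with hc <;> ext w <;> simp <;> grind
  by_cases h : a = b
  · subst h
    have e1 : {w ∈ W | G.Inc e w} = {w ∈ W | w = a} := by ext; simp [hinc]
    have e2 : {w ∈ W | G.IsLoopAt e w} = {w ∈ W | w = a} := by ext; simp [hloop, eq_comm]
    have hc : endCount G W e = if a ∈ W then 2 else 0 := by
      rw [endCount, e1, e2, hflt]
      by_cases ha : a ∈ W <;> simp [ha]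
    rw [hc]
    by_cases ha : a ∈ W <;> simp [ha, hinc]
  · have e1 : {w ∈ W | G.Inc e w} = {w ∈ W | w = a} ∪ {w ∈ W | w = b} := by
      ext; simp [hinc]; tauto
    have e2 : {w ∈ W | G.IsLoopAt e w} = ∅ := by
      ext w; simp only [hloop, Finset.mem_filter, Finset.notMem_empty, iff_false]
      rintro ⟨_, rfl, rfl⟩; exact h rfl
    have hc : endCount G W e = (if a ∈ W then 1 else 0) + (if b ∈ W then 1 else 0) := by
      rw [endCount, e1, e2, hflt, hflt]
      by_cases ha : a ∈ W <;> by_cases hb : b ∈ W <;> simp [ha, hb, h]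
    rw [hc]
    by_cases ha : a ∈ W <;> by_cases hb : b ∈ W <;> simp [ha, hb, hinc]

open Classical in
/-- Double counting of the pairs (vertex of `W`, incident edge). -/
theorem sum_degree {α β : Type*} (G : Graph α β) (W : Finset α) (Y : Finset β)
    (h : ∀ w ∈ W, ∀ e, G.Inc e w → e ∈ Y) :
    ∑ w ∈ W, degree G w = ∑ e ∈ Y, endCount G W e := by
  have hd : ∀ w ∈ W, degree G w =
      {e ∈ Y | G.Inc e w}.card + {e ∈ Y | G.IsLoopAt e w}.card := by
    intro w hw
    have h1 : G.incidenceSet w = ({e ∈ Y | G.Inc e w} : Finset β) := by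
      ext e; simpa using h w hw e
    have h2 : G.loopSet w = ({e ∈ Y | G.IsLoopAt e w} : Finset β) := by
      ext e; simpa using fun he : G.IsLoopAt e w ↦ h w hw e he.inc
    rw [degree, h1, h2, Set.ncard_coe_finset, Set.ncard_coe_finset]
  rw [Finset.sum_congr rfl hd, Finset.sum_add_distrib]
  simp only [endCount, Finset.sum_add_distrib]
  congr 1
  · exact Finset.sum_card_bipartiteAbove_eq_sum_card_bipartiteBelow (fun w e ↦ G.Inc e w)
  · exact Finset.sum_card_bipartiteAbove_eq_sum_card_bipartiteBelow (fun w e ↦ G.IsLoopAt e w)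

theorem IsCycleGraph.card_eq {α β : Type*} {H : Graph α β} (h : IsCycleGraph H) :
    E(H).ncard = V(H).ncard := by
  obtain ⟨⟨hV, hE⟩, -, hdeg⟩ := h
  have key := sum_degree H hV.toFinset hE.toFinset fun w _ e he ↦ by simpa using he.edge_mem
  rw [Finset.sum_congr rfl (g := fun _ ↦ 2) (fun w hw ↦ hdeg w (by simpa using hw)),
    Finset.sum_congr rfl (g := fun _ ↦ 2) (fun e he ↦ (endCount_le H _ e).2.2 (by simpa using he)
      fun x hx ↦ by simpa using hx.vertex_mem)] at key
  rw [Set.ncard_eq_toFinset_card _ hE, Set.ncard_eq_toFinset_card _ hV]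
  simp only [Finset.sum_const, smul_eq_mul] at key
  omega

theorem ends_mono {α β : Type*} (G : Graph α β) {X Y : Finset β} (h : X ⊆ Y) :
    ends G X ⊆ ends G Y := fun x hx ↦ by
  obtain ⟨e, he, hx⟩ := mem_ends.1 hx
  exact mem_ends.2 ⟨e, h he, hx⟩

theorem ends_pos {α β : Type*} {G : Graph α β} {X : Finset β} (hX : X.Nonempty)
    (h : (X : Set β) ⊆ E(G)) : 0 < (ends G X).card := by
  obtain ⟨e, he⟩ := hX
  obtain ⟨x, y, hxy⟩ := G.exists_isLink_of_mem_edgeSet (h he)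
  exact Finset.card_pos.2 ⟨x, mem_ends.2 ⟨e, he, hxy.inc_left⟩⟩

open Classical in
/-- A nonempty edge set `X` with `Δ(G⟨X⟩) ≥ k` contains a member of `circuits G k`. -/
theorem exists_circuit {α β : Type*} {G : Graph α β} {k : ℕ} (hk : 1 ≤ k) (X : Finset β)
    (hX : (X : Set β) ⊆ E(G)) (hne : X.Nonempty) (hc : (ends G X).card + k ≤ X.card) :
    ∃ C ∈ circuits G k, C ⊆ (X : Set β) := by
  induction X using Finset.strongInduction with
  | H X ih =>
    by_cases hmin : ∃ Y ⊂ X, Y.Nonempty ∧ (ends G Y).card + k ≤ Y.card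
    · obtain ⟨Y, hYX, hY, hYc⟩ := hmin
      have hsub : (Y : Set β) ⊆ X := by exact_mod_cast hYX.subset
      obtain ⟨C, hC, hCY⟩ := ih Y hYX (hsub.trans hX) hY hYc
      exact ⟨C, hC, hCY.trans hsub⟩
    push Not at hmin
    have hpos := ends_pos hne hX
    have hErase : ∀ e ∈ X, (X.erase e).Nonempty := fun e he ↦ by
      rw [← Finset.card_pos, Finset.card_erase_of_mem he]; omega
    refine ⟨X, ⟨hX, X.finite_toSet, ?_, ?_, ?_, ?_⟩, subset_rfl⟩
    · rw [excess_edgeInduced hX]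
      obtain ⟨e, he⟩ := id hne
      have h1 := hmin _ (Finset.erase_ssubset he) (hErase e he)
      have h2 := Finset.card_le_card (ends_mono G (Finset.erase_subset e X))
      rw [Finset.card_erase_of_mem he] at h1
      omega
    · rintro x ⟨e, he, hx⟩
      exact ⟨e, edgeInduced_inc.2 ⟨he, hx⟩⟩
    · rintro x ⟨e, he, hx⟩ hdeg
      have hfin : ((edgeInduced G (X : Set β)).incidenceSet x).Finite :=
        X.finite_toSet.subset fun f hf ↦ (edgeInduced_inc.1 hf).1
      have hpos' : 0 < ((edgeInduced G (X : Set β)).incidenceSet x).ncard :=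
        (Set.ncard_pos hfin).2 ⟨e, edgeInduced_inc.2 ⟨he, hx⟩⟩
      rw [degree] at hdeg
      obtain ⟨f, hf⟩ := Set.ncard_eq_one.1
        (show ((edgeInduced G (X : Set β)).incidenceSet x).ncard = 1 by omega)
      have huniq : ∀ g ∈ X, G.Inc g x → g = f := fun g hg hgx ↦ by
        have : g ∈ (edgeInduced G (X : Set β)).incidenceSet x := edgeInduced_inc.2 ⟨hg, hgx⟩
        simpa [hf] using this
      obtain rfl := huniq e he hx
      have h1 := hmin _ (Finset.erase_ssubset he) (hErase e he)
      have h2 : ends G (X.erase e) ⊂ ends G X := by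
        refine Finset.ssubset_iff_subset_ne.2 ⟨ends_mono G (Finset.erase_subset e X), fun heq ↦ ?_⟩
        have : x ∈ ends G (X.erase e) := heq ▸ mem_ends.2 ⟨e, he, hx⟩
        obtain ⟨g, hg, hgx⟩ := mem_ends.1 this
        rw [Finset.mem_erase] at hg
        exact hg.1 (huniq g hg.2 hgx)
      have h3 := Finset.card_lt_card h2
      rw [Finset.card_erase_of_mem he] at h1
      omega
    · rintro H ⟨hH, ⟨x₀, hx₀⟩, -⟩ hcyc
      have hcard := hcyc.card_eq
      obtain ⟨⟨hVf, hEf⟩, -, -⟩ := hcyc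
      have hEX : ∀ e ∈ E(H), e ∈ X := fun e he ↦ (hH.le.edgeSet_mono he).2
      have hVX : ∀ x ∈ V(H), x ∈ ends G X := fun x hx ↦
        mem_ends.2 (hH.le.vertexSet_mono hx)
      have hsubE : hEf.toFinset ⊆ X := fun e he ↦ hEX e (by simpa using he)
      have hsubV : hVf.toFinset ⊆ ends G X := fun e he ↦ hVX e (by simpa using he)
      rw [Set.ncard_eq_toFinset_card _ hEf, Set.ncard_eq_toFinset_card _ hVf] at hcard
      have hVpos : 0 < hVf.toFinset.card := Finset.card_pos.2 ⟨x₀, by simpa using hx₀⟩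
      have c1 := Finset.card_sdiff_of_subset hsubE
      have c2 := Finset.card_sdiff_of_subset hsubV
      have c3 := Finset.card_le_card hsubV
      have c4 := Finset.card_le_card hsubE
      have hsub : ends G (X \ hEf.toFinset) ⊆ ends G X \ hVf.toFinset := by
        intro x hx
        obtain ⟨e, he, hex⟩ := mem_ends.1 hx
        simp only [Finset.mem_sdiff, Set.Finite.mem_toFinset] at he ⊢
        exact ⟨mem_ends.2 ⟨e, he.1, hex⟩,
          fun hxH ↦ he.2 (hH.closed (edgeInduced_inc.2 ⟨he.1, hex⟩) hxH)⟩
      have c5 := Finset.card_le_card hsub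
      have h1 := hmin (X \ hEf.toFinset)
        (Finset.ssubset_iff_subset_ne.2 ⟨Finset.sdiff_subset, fun heq ↦ by
          rw [heq] at c1; omega⟩)
        (by rw [← Finset.card_pos]; omega)
      omega

/-- `Δ` strictly decreases when edges are removed from a cacti-graph. -/
theorem IsCactiGraph.excess_lt {α β : Type*} {G : Graph α β} {C X : Finset β}
    (hcac : IsCactiGraph (edgeInduced G (C : Set β))) (hX : X ⊂ C) :
    X.card + (ends G C).card < C.card + (ends G X).card := by
  classical
  set K := edgeInduced G (C : Set β) with hK
  obtain ⟨hiso, hleaf, hcyc⟩ := hcac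
  set W := ends G C \ ends G X with hW
  have cW : W.card = (ends G C).card - (ends G X).card :=
    Finset.card_sdiff_of_subset (ends_mono G hX.subset)
  have cY : (C \ X).card = C.card - X.card := Finset.card_sdiff_of_subset hX.subset
  have c1 := Finset.card_le_card (ends_mono G hX.subset)
  have c2 := Finset.card_lt_card hX
  by_contra! hcon
  have hinc : ∀ w ∈ W, ∀ e, K.Inc e w → e ∈ C \ X := by
    intro w hw e he
    rw [hK, edgeInduced_inc] at he
    rw [hW, Finset.mem_sdiff, mem_ends, mem_ends] at hw
    exact Finset.mem_sdiff.2 ⟨he.1, fun heX ↦ hw.2 ⟨e, heX, he.2⟩⟩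
  have hWV : ∀ w ∈ W, w ∈ V(K) := fun w hw ↦ by
    rw [hW, Finset.mem_sdiff, mem_ends] at hw
    exact hw.1
  have hfinE : ∀ x, (K.incidenceSet x).Finite := fun x ↦
    C.finite_toSet.subset fun e he ↦ (edgeInduced_inc.1 he).1
  have hdeg : ∀ w ∈ W, 2 ≤ degree K w := by
    intro w hw
    have h1 := hleaf w (hWV w hw)
    have h2 : 0 < (K.incidenceSet w).ncard := (Set.ncard_pos (hfinE w)).2 (hiso w (hWV w hw))
    simp only [degree] at h1 ⊢
    omega
  have hsum := sum_degree K W (C \ X) hinc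
  have s1 : ∑ _w ∈ W, 2 ≤ ∑ w ∈ W, degree K w := Finset.sum_le_sum hdeg
  have s2 : ∑ e ∈ C \ X, endCount K W e ≤ ∑ _e ∈ C \ X, 2 :=
    Finset.sum_le_sum fun e _ ↦ (endCount_le K W e).1
  have s3 : ∑ _w ∈ W, 2 = W.card * 2 := by simp
  have s4 : ∑ _e ∈ C \ X, 2 = (C \ X).card * 2 := by simp
  have hd2 : ∀ w ∈ W, 2 = degree K w := (Finset.sum_eq_sum_iff_of_le hdeg).1 (by omega)
  have he2 : ∀ e ∈ C \ X, endCount K W e = 2 :=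
    (Finset.sum_eq_sum_iff_of_le fun e _ ↦ (endCount_le K W e).1).1 (by omega)
  have hWne : W.Nonempty := by rw [← Finset.card_pos]; omega
  obtain ⟨w, hw⟩ := hWne
  have hadj : ∀ x ∈ W, ∀ y, K.Adj x y → y ∈ W := by
    rintro x hx y ⟨e, he⟩
    exact (endCount_le K W e).2.1 (he2 e (hinc x hx e he.inc_left)) y he.inc_right
  set D : Set α := {y | Relation.ReflTransGen K.Adj w y} with hD
  have hDW : ∀ y ∈ D, y ∈ W := by
    intro y hy
    induction hy with
    | refl => exact hw
    | tail _ h ih => exact hadj _ ih _ h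
  have hDlink : ∀ {e x y}, K.IsLink e x y → x ∈ D → y ∈ D := fun {e x y} h hx ↦
    Relation.ReflTransGen.tail (b := x) hx ⟨e, h⟩
  set H := K.induce D with hH
  have hlink : ∀ {e x y}, H.IsLink e x y ↔ K.IsLink e x y ∧ x ∈ D ∧ y ∈ D := Iff.rfl
  have hHD : V(H) = D := rfl
  have hHle : H ≤ K := Graph.induce_le fun y hy ↦ hWV y (hDW y hy)
  have hHadj : ∀ x ∈ D, Relation.ReflTransGen H.Adj w x := by
    intro x hx
    have hx' : Relation.ReflTransGen K.Adj w x := hx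
    induction hx' with
    | refl => exact Relation.ReflTransGen.refl
    | @tail b c hb hbc ih =>
      obtain ⟨e, he⟩ := hbc
      exact (ih hb).tail ⟨e, hlink.2 ⟨he, hb, hx⟩⟩
  have hsymm : Std.Symm (Relation.ReflTransGen H.Adj) := Relation.ReflTransGen.stdSymm
  have hconn : IsConnected H := by
    refine ⟨⟨w, Relation.ReflTransGen.refl⟩, fun x hx y hy ↦ ?_⟩
    refine Relation.ReflTransGen.trans ?_ (hHadj y hy)
    exact Std.Symm.symm _ _ (hHadj x hx)
  have hclosed : H.IsClosedSubgraph K :=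
    { vertexSet_mono := hHle.vertexSet_mono
      isLink_mono := hHle.isLink_mono
      isLink_of_mem_mem := fun e x y h hx hy ↦ hlink.2 ⟨h, hx, hy⟩
      closed := fun e x ⟨y, h⟩ hx ↦ (hlink.2 ⟨h, hx, hDlink h hx⟩).edge_mem }
  refine hcyc H ⟨hclosed, hconn⟩ ⟨⟨?_, ?_⟩, hconn, fun x hx ↦ ?_⟩
  · exact W.finite_toSet.subset hDW
  · exact C.finite_toSet.subset fun e he ↦ (hHle.edgeSet_mono he).2
  · have i1 : H.incidenceSet x = K.incidenceSet x := by
      ext e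
      exact ⟨fun ⟨y, h⟩ ↦ ⟨y, (hlink.1 h).1⟩, fun ⟨y, h⟩ ↦ ⟨y, hlink.2 ⟨h, hx, hDlink h hx⟩⟩⟩
    have i2 : H.loopSet x = K.loopSet x := by
      ext e
      exact ⟨fun h ↦ (hlink.1 h).1, fun h ↦ hlink.2 ⟨h, hx, hx⟩⟩
    rw [degree, i1, i2]
    exact (hd2 x (hDW x hx)).symm

/-- A finite edge set is independent in `M_k(G)` if it contains no member of `circuits G k`. -/
def IndepSet {α β : Type*} (G : Graph α β) (k : ℕ) (I : Finset β) : Prop :=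
  (I : Set β) ⊆ E(G) ∧ ∀ C ∈ circuits G k, ¬ C ⊆ (I : Set β)

theorem indepSet_iff {α β : Type*} {G : Graph α β} {k : ℕ} (hk : 1 ≤ k) {I : Finset β} :
    IndepSet G k I ↔ (I : Set β) ⊆ E(G) ∧
      ∀ X ⊆ I, X.Nonempty → X.card < (ends G X).card + k := by
  refine and_congr_right fun hI ↦ ⟨fun h X hXI hX ↦ ?_, fun h C hC hCI ↦ ?_⟩
  · by_contra! hcon
    have hsub : (X : Set β) ⊆ I := by exact_mod_cast hXI
    obtain ⟨C, hC, hCX⟩ := exists_circuit hk X (hsub.trans hI) hX hcon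
    exact h C hC (hCX.trans hsub)
  · obtain ⟨hCE, hCf, hex, -⟩ := hC
    lift C to Finset β using hCf
    rw [excess_edgeInduced hCE] at hex
    have hne : C.Nonempty := by rw [← Finset.card_pos]; omega
    have := h C (by exact_mod_cast hCI) hne
    omega

theorem indepSet_empty {α β : Type*} (G : Graph α β) {k : ℕ} (hk : 1 ≤ k) : IndepSet G k ∅ := by
  rw [indepSet_iff hk]
  refine ⟨by simp, fun X hX hne ↦ ?_⟩
  rw [Finset.subset_empty.1 hX] at hne
  exact absurd hne Finset.not_nonempty_empty

theorem IndepSet.subset {α β : Type*} {G : Graph α β} {k : ℕ} {I J : Finset β}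
    (hJ : IndepSet G k J) (hIJ : I ⊆ J) : IndepSet G k I :=
  ⟨(Finset.coe_subset.2 hIJ).trans hJ.1,
    fun C hC hCI ↦ hJ.2 C hC (hCI.trans (Finset.coe_subset.2 hIJ))⟩

open Classical in
theorem indepSet_aug {α β : Type*} {G : Graph α β} {k : ℕ} (hk : 1 ≤ k) ⦃I J : Finset β⦄
    (hI : IndepSet G k I) (hJ : IndepSet G k J) (hIJ : I.card < J.card) :
    ∃ e ∈ J, e ∉ I ∧ IndepSet G k (insert e I) := by
  rw [indepSet_iff hk] at hI hJ
  by_contra! hcon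
  obtain ⟨hIE, hI⟩ := hI
  obtain ⟨hJE, hJ⟩ := hJ
  -- the tight subsets of `I`, and the maximal ones
  set 𝒯 := {T ∈ I.powerset | T.Nonempty ∧ (ends G T).card + k = T.card + 1} with h𝒯
  have tight : ∀ {T}, T ∈ 𝒯 ↔ T ⊆ I ∧ T.Nonempty ∧ (ends G T).card + k = T.card + 1 := by
    simp [h𝒯]
  have hunion : ∀ S ∈ 𝒯, ∀ T ∈ 𝒯, (S ∩ T).Nonempty → S ∪ T ∈ 𝒯 := by
    intro S hS T hT hST
    rw [tight] at hS hT ⊢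
    have hsub : S ∪ T ⊆ I := Finset.union_subset hS.1 hT.1
    have hne : (S ∪ T).Nonempty := hS.2.1.mono Finset.subset_union_left
    have a1 := hI _ hsub hne
    have a2 := hI _ (Finset.inter_subset_left.trans hS.1) hST
    have a3 := Finset.card_union_add_card_inter S T
    have a4 := Finset.card_union_add_card_inter (ends G S) (ends G T)
    have a5 : ends G (S ∪ T) = ends G S ∪ ends G T := by
      ext x; simp only [Finset.mem_union, mem_ends]
      constructor
      · rintro ⟨e, he | he, hx⟩
        exacts [Or.inl ⟨e, he, hx⟩, Or.inr ⟨e, he, hx⟩]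
      · rintro (⟨e, he, hx⟩ | ⟨e, he, hx⟩)
        exacts [⟨e, Or.inl he, hx⟩, ⟨e, Or.inr he, hx⟩]
    have a6 : (ends G (S ∩ T)).card ≤ (ends G S ∩ ends G T).card :=
      Finset.card_le_card (Finset.subset_inter (ends_mono G Finset.inter_subset_left)
        (ends_mono G Finset.inter_subset_right))
    rw [← a5] at a4
    exact ⟨hsub, hne, by omega⟩
  have htight : ∀ e ∈ J, e ∉ I → ∃ T ∈ 𝒯, ∀ x, G.Inc e x → x ∈ ends G T := by
    intro e heJ heI
    have hne := hcon e heJ heI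
    have hins : ((insert e I : Finset β) : Set β) ⊆ E(G) := by
      rw [Finset.coe_insert]
      exact Set.insert_subset (hJE heJ) hIE
    rw [indepSet_iff hk] at hne
    push Not at hne
    obtain ⟨X, hX, hXne, hXc⟩ := hne hins
    have heX : e ∈ X := by
      by_contra heX
      have := hI X (fun f hf ↦ (Finset.mem_insert.1 (hX hf)).resolve_left
        (fun h ↦ heX (h ▸ hf))) hXne
      omega
    have hT : X.erase e ⊆ I := fun f hf ↦ by
      rw [Finset.mem_erase] at hf
      exact (Finset.mem_insert.1 (hX hf.2)).resolve_left hf.1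
    have hXpos := ends_pos hXne (fun f hf ↦ hins (hX hf))
    have hc := Finset.card_erase_of_mem heX
    have hTne : (X.erase e).Nonempty := by rw [← Finset.card_pos]; omega
    have b1 := hI _ hT hTne
    have b2 := Finset.card_le_card (ends_mono G (Finset.erase_subset e X))
    refine ⟨X.erase e, tight.2 ⟨hT, hTne, by omega⟩, fun x hx ↦ ?_⟩
    rw [Finset.eq_of_subset_of_card_le (ends_mono G (Finset.erase_subset e X)) (by omega)]
    exact mem_ends.2 ⟨e, heX, hx⟩
  set ℳ := {T ∈ 𝒯 | ∀ S ∈ 𝒯, T ⊆ S → S = T} with hℳ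
  have hmax : ∀ T ∈ 𝒯, ∃ S ∈ ℳ, T ⊆ S := by
    intro T hT
    obtain ⟨S, hTS, hS⟩ := 𝒯.exists_le_maximal hT
    refine ⟨S, Finset.mem_filter.2 ⟨hS.prop, fun R hR hSR ↦ ?_⟩, hTS⟩
    exact (hS.eq_of_le hR hSR).symm
  have hdisj : (ℳ : Set (Finset β)).PairwiseDisjoint id := by
    intro S hS T hT hne
    simp only [hℳ, Finset.coe_filter, Set.mem_ofPred_eq] at hS hT
    by_contra hnd
    have hU := hunion S hS.1 T hT.1 (Finset.not_disjoint_iff_nonempty_inter.1 hnd)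
    exact hne ((hS.2 _ hU Finset.subset_union_left).symm.trans
      (hT.2 _ hU Finset.subset_union_right))
  set U := ℳ.biUnion id with hU
  have hUI : U ⊆ I := by
    intro f hf
    obtain ⟨T, hT, hfT⟩ := Finset.mem_biUnion.1 hf
    exact (tight.1 (Finset.mem_filter.1 hT).1).1 hfT
  let P : Finset β → Finset β := fun T ↦ {f ∈ J | ∀ x, G.Inc f x → x ∈ ends G T}
  have hP : ∀ T ∈ ℳ, (P T).card ≤ T.card := by
    intro T hT
    obtain ⟨-, -, hTc⟩ := tight.1 (Finset.mem_filter.1 hT).1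
    rcases (P T).eq_empty_or_nonempty with h | h
    · simp [h]
    have d1 := hJ (P T) (Finset.filter_subset _ _) h
    have d2 : (ends G (P T)).card ≤ (ends G T).card := Finset.card_le_card fun x hx ↦ by
      obtain ⟨f, hf, hfx⟩ := mem_ends.1 hx
      exact (Finset.mem_filter.1 hf).2 x hfx
    omega
  have hcover : J ⊆ ℳ.biUnion P ∪ (I \ U) := by
    intro f hf
    rw [Finset.mem_union, Finset.mem_biUnion, Finset.mem_sdiff]
    by_cases hfU : f ∈ U
    · obtain ⟨T, hT, hfT⟩ := Finset.mem_biUnion.1 hfU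
      exact Or.inl ⟨T, hT, Finset.mem_filter.2 ⟨hf, fun x hx ↦ mem_ends.2 ⟨f, hfT, hx⟩⟩⟩
    by_cases hfI : f ∈ I
    · exact Or.inr ⟨hfI, hfU⟩
    · obtain ⟨T, hT, hfT⟩ := htight f hf hfI
      obtain ⟨S, hS, hTS⟩ := hmax T hT
      exact Or.inl ⟨S, hS, Finset.mem_filter.2 ⟨hf, fun x hx ↦ ends_mono G hTS (hfT x hx)⟩⟩
  have f1 := Finset.card_le_card hcover
  have f2 := Finset.card_union_le (ℳ.biUnion P) (I \ U)
  have f3 : (ℳ.biUnion P).card ≤ ∑ T ∈ ℳ, T.card :=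
    Finset.card_biUnion_le.trans (Finset.sum_le_sum hP)
  have f4 : U.card = ∑ T ∈ ℳ, T.card := Finset.card_biUnion hdisj
  have f5 := Finset.card_sdiff_of_subset hUI
  have f6 := Finset.card_le_card hUI
  omega

open Classical in
/-- The `k`-circular matroid `M_k(G)` of `G` (`k ≥ 1`): the matroid on `E(G)` whose circuits are the
members of `circuits G k` (see `kCircularMatroid_isCircuit_iff`). For `k = 1` it is the bicircular
matroid of `G`. -/
noncomputable def kCircularMatroid {α β : Type*} (G : Graph α β) (k : ℕ) (hk : 1 ≤ k) : Matroid β :=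
  (IndepMatroid.ofFinset E(G) (IndepSet G k)
    (indepSet_empty G hk) (fun _ _ hJ hIJ ↦ hJ.subset hIJ) (indepSet_aug hk) (fun _ hI ↦ hI.1)).matroid

theorem kCircularMatroid_ground {α β : Type*} (G : Graph α β) (k : ℕ) (hk : 1 ≤ k) :
    (kCircularMatroid G k hk).E = E(G) := rfl

theorem kCircularMatroid_indep_iff {α β : Type*} (G : Graph α β) (k : ℕ) (hk : 1 ≤ k)
    (I : Set β) :
    (kCircularMatroid G k hk).Indep I ↔ I ⊆ E(G) ∧ ∀ C ∈ circuits G k, ¬ C ⊆ I := by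
  classical
  have h0 : (kCircularMatroid G k hk).Indep I ↔
      ∀ J : Finset β, (J : Set β) ⊆ I → IndepSet G k J := by
      rw [kCircularMatroid, IndepMatroid.matroid_Indep, IndepMatroid.ofFinset_indep']
  rw [h0]
  refine ⟨fun h ↦ ⟨fun e he ↦ ?_, fun C hC hCI ↦ ?_⟩, fun h J hJ ↦
    ⟨hJ.trans h.1, fun C hC hCJ ↦ h.2 C hC (hCJ.trans hJ)⟩⟩
  · exact (h {e} (by simpa using he)).1 (by simp)
  · obtain ⟨D, rfl⟩ := hC.2.1.exists_finset_coe
    exact (h D hCI).2 _ hC subset_rfl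

theorem kCircularMatroid_isCircuit_iff {α β : Type*} (G : Graph α β) (k : ℕ) (hk : 1 ≤ k)
    (C : Set β) : (kCircularMatroid G k hk).IsCircuit C ↔ C ∈ circuits G k := by
  rw [Matroid.isCircuit_iff_forall_ssubset, Matroid.dep_iff, kCircularMatroid_indep_iff,
    kCircularMatroid_ground]
  constructor
  · rintro ⟨⟨hdep, hCE⟩, hmin⟩
    push Not at hdep
    obtain ⟨D, hD, hDC⟩ := hdep hCE
    rcases hDC.eq_or_ssubset with rfl | hss
    · exact hD
    · exact absurd subset_rfl (((kCircularMatroid_indep_iff G k hk D).1 (hmin hss)).2 D hD)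
  · intro hC
    refine ⟨⟨fun h ↦ h.2 C hC subset_rfl, hC.1⟩, fun I hI ↦ ?_⟩
    rw [kCircularMatroid_indep_iff]
    refine ⟨hI.subset.trans hC.1, fun D hD hDI ↦ ?_⟩
    have hDC : D ⊂ C := hDI.trans_ssubset hI
    obtain ⟨hCE, hCf, hCk, hCc⟩ := hC
    obtain ⟨hDE, hDf, hDk, -⟩ := hD
    lift C to Finset β using hCf
    lift D to Finset β using hDf
    have := hCc.excess_lt (by exact_mod_cast hDC)
    rw [excess_edgeInduced hCE] at hCk
    rw [excess_edgeInduced hDE] at hDk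
    omega

end KCircular

/-! Hall's theorem, applied to the vertices of `G⟨X⟩` and the edges of `X`, shows that `X` has rank
`|V(G⟨X⟩)|` in the bicircular matroid as soon as `G⟨X⟩` has no leaves, and that even `X \ {e}` has
this rank if `G⟨X⟩` is a cacti-graph. An edge with an end outside `V(G⟨X⟩)` is never spanned by `X`;
hence a set without coloops is leafless in every graph with that bicircular matroid.

Put `X = E(G \ x)`. Then `X` and `E(G)` are leafless in `G` and in `G'`. Comparing their ranks,
`V(G'⟨X⟩)` misses exactly one vertex `x'` of `G'`, and both `S(x, G)` and `S(x', G')` are the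
complement of the closure of `X`. -/

namespace KCircular

open scoped Finset

variable {α α' β : Type*} {G H : Graph α β} {G' : Graph α' β}

theorem coe_ends (G : Graph α β) (X : Finset β) :
    (ends G X : Set α) = V(edgeInduced G (X : Set β)) := by
  simp only [ends, Set.Finite.coe_toFinset]

theorem edgeInduced_edgeSet_of_le (hHG : H ≤ G) (hH : NoIsolatedVertices H) :
    edgeInduced G E(H) = H := by
  refine Graph.ext_inc (Set.ext fun x ↦ ⟨?_, fun hx ↦ ?_⟩) fun e x ↦ ?_
  · rintro ⟨e, he, hex⟩
    exact ((hHG.inc_congr he).2 hex).vertex_mem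
  · obtain ⟨e, he⟩ := hH x hx
    exact ⟨e, he.edge_mem, he.mono hHG⟩
  · rw [edgeInduced_inc]
    exact ⟨fun ⟨he, hex⟩ ↦ (hHG.inc_congr he).2 hex, fun h ↦ ⟨h.edge_mem, h.mono hHG⟩⟩

theorem coe_ends_of_le (hHG : H ≤ G) (hH : NoIsolatedVertices H) {X : Finset β}
    (hX : (X : Set β) = E(H)) : (ends G X : Set α) = V(H) := by
  rw [coe_ends, hX, edgeInduced_edgeSet_of_le hHG hH]

theorem NoLeaves.two_le_degree (hG : NoLeaves G) (hE : E(G).Finite) {e : β} {x : α}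
    (hx : G.Inc e x) : 2 ≤ degree G x := by
  have hpos : 0 < (G.incidenceSet x).ncard :=
    (Set.ncard_pos (hE.subset (G.incidenceSet_subset_edgeSet x))).2 ⟨e, hx⟩
  have hne : degree G x ≠ 1 := hG x hx.vertex_mem
  unfold degree at hne ⊢
  omega

/-! ### Counting the edges that meet a set of vertices -/

open Classical in
/-- The edges of `X` with an end in `U`. This is the neighbourhood of `U` in the bipartite graph
of incidences between vertices and edges of `X`, to which Hall's theorem is applied. -/
noncomputable def edgesMeeting (G : Graph α β) (X : Finset β) (U : Finset α) : Finset β :=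
  {e ∈ X | ∃ u ∈ U, G.Inc e u}

theorem mem_edgesMeeting {X : Finset β} {U : Finset α} {e : β} :
    e ∈ edgesMeeting G X U ↔ e ∈ X ∧ ∃ u ∈ U, G.Inc e u := by
  simp only [edgesMeeting, Finset.mem_filter]

theorem NoLeaves.card_le_card_edgesMeeting {X : Finset β}
    (hX : NoLeaves (edgeInduced G (X : Set β))) {U : Finset α} (hU : U ⊆ ends G X) :
    #U ≤ #(edgesMeeting G X U) := by
  have hfin : E(edgeInduced G (X : Set β)).Finite := X.finite_toSet.inter_of_right _
  have hdeg : ∀ u ∈ U, 2 ≤ degree (edgeInduced G (X : Set β)) u := fun u hu ↦ by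
    obtain ⟨e, heX, heu⟩ := mem_ends.1 (hU hu)
    exact hX.two_le_degree hfin (edgeInduced_inc.2 ⟨heX, heu⟩)
  refine Nat.le_of_mul_le_mul_right ?_ two_pos
  calc #U * 2 ≤ ∑ u ∈ U, degree (edgeInduced G (X : Set β)) u :=
        Finset.card_nsmul_le_sum U _ 2 hdeg
    _ = ∑ e ∈ edgesMeeting G X U, endCount (edgeInduced G (X : Set β)) U e :=
        sum_degree _ U _ fun u hu e he ↦
          have ⟨heX, heu⟩ := edgeInduced_inc.1 he
          mem_edgesMeeting.2 ⟨heX, u, hu, heu⟩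
    _ ≤ #(edgesMeeting G X U) * 2 :=
        Finset.sum_le_card_nsmul _ _ 2 fun e _ ↦ (endCount_le _ U e).1

theorem IsCactiGraph.card_lt_card_edgesMeeting {X : Finset β}
    (hX : IsCactiGraph (edgeInduced G (X : Set β))) {U : Finset α} (hU : U ⊆ ends G X)
    (hne : U.Nonempty) : #U < #(edgesMeeting G X U) := by
  classical
  set N := edgesMeeting G X U
  have hNX : N ⊆ X := Finset.filter_subset _ _
  have hN : N.Nonempty := by
    obtain ⟨u, hu⟩ := hne
    obtain ⟨e, heX, heu⟩ := mem_ends.1 (hU hu)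
    exact ⟨e, mem_edgesMeeting.2 ⟨heX, u, hu, heu⟩⟩
  have hends : ends G (X \ N) ⊆ ends G X \ U := fun v hv ↦ by
    obtain ⟨e, he, hev⟩ := mem_ends.1 hv
    obtain ⟨heX, heN⟩ := Finset.mem_sdiff.1 he
    exact Finset.mem_sdiff.2
      ⟨mem_ends.2 ⟨e, heX, hev⟩, fun hvU ↦ heN (mem_edgesMeeting.2 ⟨heX, v, hvU, hev⟩)⟩
  have hlt := hX.excess_lt (Finset.sdiff_ssubset hNX hN)
  have hle := Finset.card_le_card hends
  have hXN := Finset.card_sdiff_add_card_eq_card hNX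
  have hXU := Finset.card_sdiff_add_card_eq_card hU
  omega

theorem IndepSet.card_le_card_ends {I : Finset β} (hI : IndepSet G 1 I) : #I ≤ #(ends G I) := by
  rcases I.eq_empty_or_nonempty with rfl | hne
  · exact Nat.zero_le _
  · exact Nat.lt_succ_iff.1 (((indepSet_iff le_rfl).1 hI).2 I subset_rfl hne)

open Classical in
theorem IndepSet.insert_of_notMem_ends {k : ℕ} (hk : 1 ≤ k) {I : Finset β} (hI : IndepSet G k I)
    {e : β} {x : α} (hex : G.Inc e x) (hx : x ∉ ends G I) : IndepSet G k (insert e I) := by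
  obtain ⟨hIE, hIcard⟩ := (indepSet_iff hk).1 hI
  refine (indepSet_iff hk).2 ⟨?_, fun Y hY hYne ↦ ?_⟩
  · rw [Finset.coe_insert]
    exact Set.insert_subset hex.edge_mem hIE
  have hYI : Y.erase e ⊆ I := Finset.subset_insert_iff.1 hY
  by_cases heY : e ∈ Y
  swap
  · rw [Finset.erase_eq_of_notMem heY] at hYI
    exact hIcard Y hYI hYne
  have hends : #(ends G (Y.erase e)) < #(ends G Y) :=
    Finset.card_lt_card <| (Finset.ssubset_iff_of_subset (ends_mono G (Y.erase_subset e))).2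
      ⟨x, mem_ends.2 ⟨e, heY, hex⟩, fun h ↦ hx (ends_mono G hYI h)⟩
  have hcard : #(Y.erase e) + 1 = #Y := Finset.card_erase_add_one heY
  rcases (Y.erase e).eq_empty_or_nonempty with hempty | hne
  · rw [hempty, Finset.card_empty] at hcard
    omega
  · have := hIcard _ hYI hne
    omega

open Classical in
theorem indepSet_image_of_forall_inc {ι : Type*} [Fintype ι] {f : ι → β} {v : ι → α}
    (hv : v.Injective) (hfv : ∀ i, G.Inc (f i) (v i)) :
    IndepSet G 1 (Finset.univ.image f) := by
  refine (indepSet_iff le_rfl).2 ⟨?_, fun Y hY _ ↦ Nat.lt_succ_iff.2 ?_⟩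
  · rintro _ he
    obtain ⟨i, -, rfl⟩ := Finset.mem_image.1 he
    exact (hfv i).edge_mem
  calc #Y ≤ #(({i | f i ∈ Y} : Finset ι).image f) := Finset.card_le_card fun e he ↦ by
        obtain ⟨i, -, rfl⟩ := Finset.mem_image.1 (hY he)
        exact Finset.mem_image_of_mem f (by simpa using he)
    _ ≤ #({i | f i ∈ Y} : Finset ι) := Finset.card_image_le
    _ = #(({i | f i ∈ Y} : Finset ι).image v) := (Finset.card_image_of_injective _ hv).symm
    _ ≤ #(ends G Y) := Finset.card_le_card <| Finset.image_subset_iff.2 fun i hi ↦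
        mem_ends.2 ⟨f i, by simpa using hi, hfv i⟩

theorem exists_indepSet_card_eq_of_forall_card_le {X : Finset β} {W : Finset α}
    (hall : ∀ U ⊆ W, #U ≤ #(edgesMeeting G X U)) : ∃ I ⊆ X, IndepSet G 1 I ∧ #I = #W := by
  classical
  obtain ⟨f, hf, hfmem⟩ := (Finset.all_card_le_biUnion_card_iff_exists_injective
    fun w : W ↦ edgesMeeting G X {w.1}).1 fun s ↦ by
      have hs : s.map (Function.Embedding.subtype _) ⊆ W := Finset.map_subtype_subset s
      refine (Finset.card_map _).symm.trans_le <| (hall _ hs).trans <|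
        Finset.card_le_card fun e he ↦ ?_
      obtain ⟨heX, u, hu, heu⟩ := mem_edgesMeeting.1 he
      obtain ⟨w, hw, rfl⟩ := Finset.mem_map.1 hu
      exact Finset.mem_biUnion.2
        ⟨w, hw, mem_edgesMeeting.2 ⟨heX, w.1, Finset.mem_singleton_self _, heu⟩⟩
  have hinc : ∀ w, f w ∈ X ∧ G.Inc (f w) w := fun w ↦ by
    simpa only [mem_edgesMeeting, Finset.mem_singleton, exists_eq_left] using hfmem w
  refine ⟨Finset.univ.image f, Finset.image_subset_iff.2 fun w _ ↦ (hinc w).1,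
    indepSet_image_of_forall_inc Subtype.val_injective fun w ↦ (hinc w).2, ?_⟩
  rw [Finset.card_image_of_injective _ hf, Finset.card_univ, Fintype.card_coe]

theorem NoLeaves.exists_indepSet_card_eq_card_ends {X : Finset β}
    (hX : NoLeaves (edgeInduced G (X : Set β))) : ∃ I ⊆ X, IndepSet G 1 I ∧ #I = #(ends G X) :=
  exists_indepSet_card_eq_of_forall_card_le fun _ ↦ hX.card_le_card_edgesMeeting

open Classical in
theorem IsCactiGraph.exists_indepSet_erase_card_eq_card_ends {X : Finset β}
    (hX : IsCactiGraph (edgeInduced G (X : Set β))) (e : β) :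
    ∃ I ⊆ X.erase e, IndepSet G 1 I ∧ #I = #(ends G X) := by
  refine exists_indepSet_card_eq_of_forall_card_le fun U hU ↦ ?_
  rcases U.eq_empty_or_nonempty with rfl | hne
  · exact Nat.zero_le _
  have hsub : (edgesMeeting G X U).erase e ⊆ edgesMeeting G (X.erase e) U := fun f hf ↦ by
    obtain ⟨hfe, hf⟩ := Finset.mem_erase.1 hf
    obtain ⟨hfX, hfU⟩ := mem_edgesMeeting.1 hf
    exact mem_edgesMeeting.2 ⟨Finset.mem_erase.2 ⟨hfe, hfX⟩, hfU⟩
  calc #U ≤ #(edgesMeeting G X U) - 1 := Nat.le_sub_one_of_lt (hX.card_lt_card_edgesMeeting hU hne)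
    _ ≤ #((edgesMeeting G X U).erase e) := Finset.pred_card_le_card_erase
    _ ≤ #(edgesMeeting G (X.erase e) U) := Finset.card_le_card hsub

/-! ### Rank and closure in the bicircular matroid -/

/-- The bicircular matroid `M_1(G)`, the case `k = 1` of `kCircularMatroid`. -/
noncomputable abbrev bicircularMatroid (G : Graph α β) : Matroid β :=
  kCircularMatroid G 1 le_rfl

theorem kCircularMatroid_indep_coe {k : ℕ} (hk : 1 ≤ k) {I : Finset β} :
    (kCircularMatroid G k hk).Indep (I : Set β) ↔ IndepSet G k I :=
  kCircularMatroid_indep_iff G k hk I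

theorem notMem_closure_of_inc_of_notMem_ends {k : ℕ} (hk : 1 ≤ k) {X : Finset β} {e : β} {x : α}
    (hex : G.Inc e x) (hx : x ∉ ends G X) : e ∉ (kCircularMatroid G k hk).closure X := by
  classical
  obtain ⟨I, hI⟩ := (kCircularMatroid G k hk).exists_isBasis' X
  lift I to Finset β using X.finite_toSet.subset hI.subset
  have hxI : x ∉ ends G I := fun h ↦ hx (ends_mono G (Finset.coe_subset.1 hI.subset) h)
  rw [← hI.closure_eq_closure, hI.indep.notMem_closure_iff hex.edge_mem, ← Finset.coe_insert,
    kCircularMatroid_indep_coe]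
  exact ⟨((kCircularMatroid_indep_coe hk).1 hI.indep).insert_of_notMem_ends hk hex hxI,
    fun heI ↦ hxI (mem_ends.2 ⟨e, heI, hex⟩)⟩

open Classical in
theorem IndepSet.mem_closure_of_card_ends_insert_le {I : Finset β} (hI : IndepSet G 1 I) {e : β}
    (he : e ∈ E(G)) (hcard : #(ends G (insert e I)) ≤ #I) :
    e ∈ (bicircularMatroid G).closure I := by
  by_contra hecl
  rw [((kCircularMatroid_indep_coe le_rfl).2 hI).notMem_closure_iff he, ← Finset.coe_insert,
    kCircularMatroid_indep_coe] at hecl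
  obtain ⟨hins, heI⟩ := hecl
  have := hins.card_le_card_ends
  rw [Finset.card_insert_of_notMem heI] at this
  omega

theorem eRk_bicircularMatroid_le (G : Graph α β) (X : Finset β) :
    (bicircularMatroid G).eRk X ≤ #(ends G X) := by
  refine Matroid.eRk_le_iff.2 fun I hIX hI ↦ ?_
  lift I to Finset β using X.finite_toSet.subset hIX
  rw [Set.encard_coe_eq_coe_finsetCard, Nat.cast_le]
  exact ((kCircularMatroid_indep_coe le_rfl).1 hI).card_le_card_ends.trans
    (Finset.card_le_card (ends_mono G (Finset.coe_subset.1 hIX)))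

theorem NoLeaves.eRk_bicircularMatroid_eq {X : Finset β}
    (hX : NoLeaves (edgeInduced G (X : Set β))) :
    (bicircularMatroid G).eRk X = #(ends G X) := by
  obtain ⟨I, hIX, hI, hcard⟩ := hX.exists_indepSet_card_eq_card_ends
  refine (eRk_bicircularMatroid_le G X).antisymm ?_
  rw [← hcard, ← Set.encard_coe_eq_coe_finsetCard]
  exact ((kCircularMatroid_indep_coe le_rfl).2 hI).encard_le_eRk_of_subset (by exact_mod_cast hIX)

theorem NoLeaves.mem_closure_iff {X : Finset β} (hX : NoLeaves (edgeInduced G (X : Set β)))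
    {e : β} (he : e ∈ E(G)) :
    e ∈ (bicircularMatroid G).closure X ↔ ∀ x, G.Inc e x → x ∈ ends G X := by
  classical
  refine ⟨fun hecl x hex ↦ ?_, fun hends ↦ ?_⟩
  · by_contra hx
    exact notMem_closure_of_inc_of_notMem_ends le_rfl hex hx hecl
  obtain ⟨I, hIX, hI, hcard⟩ := hX.exists_indepSet_card_eq_card_ends
  refine Matroid.closure_subset_closure _ (Finset.coe_subset.2 hIX)
    (hI.mem_closure_of_card_ends_insert_le he (hcard ▸ Finset.card_le_card fun x hx ↦ ?_))
  obtain ⟨f, hf, hfx⟩ := mem_ends.1 hx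
  rcases Finset.mem_insert.1 hf with rfl | hfI
  · exact hends x hfx
  · exact mem_ends.2 ⟨f, hIX hfI, hfx⟩

theorem IsCactiGraph.mem_closure_sdiff_singleton {X : Finset β}
    (hX : IsCactiGraph (edgeInduced G (X : Set β))) {e : β} (heX : e ∈ X) (he : e ∈ E(G)) :
    e ∈ (bicircularMatroid G).closure (X \ {e}) := by
  classical
  obtain ⟨I, hIX, hI, hcard⟩ := hX.exists_indepSet_erase_card_eq_card_ends e
  have hins : insert e I ⊆ X := Finset.insert_subset heX (hIX.trans (X.erase_subset e))
  rw [← Finset.coe_erase]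
  exact Matroid.closure_subset_closure _ (Finset.coe_subset.2 hIX)
    (hI.mem_closure_of_card_ends_insert_le he (hcard ▸ Finset.card_le_card (ends_mono G hins)))

theorem noLeaves_of_forall_mem_closure {k : ℕ} (hk : 1 ≤ k) {X : Finset β}
    (hX : ∀ e ∈ X, e ∈ (kCircularMatroid G k hk).closure (X \ {e})) :
    NoLeaves (edgeInduced G (X : Set β)) := by
  classical
  rintro x ⟨e, heX, hex⟩ hdeg
  set S := (edgeInduced G (X : Set β)).incidenceSet x
  have heS : e ∈ S := edgeInduced_inc.2 ⟨heX, hex⟩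
  have hSfin : S.Finite := X.finite_toSet.subset fun f hf ↦ (edgeInduced_inc.1 hf).1
  have hScard : S.ncard ≤ 1 := (Nat.le_add_right _ _).trans hdeg.le
  have hx : x ∉ ends G (X.erase e) := fun h ↦ by
    obtain ⟨f, hf, hfx⟩ := mem_ends.1 h
    obtain ⟨hfe, hfX⟩ := Finset.mem_erase.1 hf
    exact hfe ((Set.ncard_le_one hSfin).1 hScard f (edgeInduced_inc.2 ⟨hfX, hfx⟩) e heS)
  refine notMem_closure_of_inc_of_notMem_ends hk hex hx ?_
  rw [Finset.coe_erase]
  exact hX e heX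

theorem IsCactiGraph.noLeaves_of_bicircularMatroid_eq
    (hM : bicircularMatroid G' = bicircularMatroid G) {X : Finset β} (hXE : (X : Set β) ⊆ E(G))
    (hX : IsCactiGraph (edgeInduced G (X : Set β))) : NoLeaves (edgeInduced G' (X : Set β)) := by
  refine noLeaves_of_forall_mem_closure le_rfl fun e heX ↦ ?_
  have h := hX.mem_closure_sdiff_singleton heX (hXE heX)
  rwa [← hM] at h

theorem IsCactiGraph.card_ends_eq_of_bicircularMatroid_eq
    (hM : bicircularMatroid G' = bicircularMatroid G) {X : Finset β} (hXE : (X : Set β) ⊆ E(G))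
    (hX : IsCactiGraph (edgeInduced G (X : Set β))) : #(ends G' X) = #(ends G X) := by
  have h := (hX.noLeaves_of_bicircularMatroid_eq hM hXE).eRk_bicircularMatroid_eq
  rw [hM, NoLeaves.eRk_bicircularMatroid_eq hX.2.1] at h
  exact_mod_cast h.symm

theorem encard_vertexSet_eq_of_bicircularMatroid_eq (hE : E(G).Finite)
    (hG' : NoIsolatedVertices G') (hM : bicircularMatroid G' = bicircularMatroid G)
    (hG : IsCactiGraph G) : V(G').encard = V(G).encard := by
  obtain ⟨F, hF⟩ := hE.exists_finset_coe
  have hEE : E(G') = E(G) := congrArg Matroid.E hM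
  rw [← coe_ends_of_le le_rfl hG' (hF.trans hEE.symm), ← coe_ends_of_le le_rfl hG.1 hF,
    Set.encard_coe_eq_coe_finsetCard, Set.encard_coe_eq_coe_finsetCard,
    IsCactiGraph.card_ends_eq_of_bicircularMatroid_eq hM hF.le
      (by rwa [hF, edgeInduced_edgeSet_of_le le_rfl hG.1])]

theorem finite_vertexSet_of_finite_edgeSet (hG : NoIsolatedVertices G) (hE : E(G).Finite) :
    V(G).Finite := by
  obtain ⟨F, hF⟩ := hE.exists_finset_coe
  exact coe_ends_of_le le_rfl hG hF ▸ (ends G F).finite_toSet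

/-! ### Vertex stars -/

theorem star_eq_edgeSet_sdiff_closure {X : Finset β} (hX : NoLeaves (edgeInduced G (X : Set β)))
    {x : α} (hx : x ∉ ends G X) (hV : V(G) ⊆ insert x (ends G X : Set α)) :
    star G x = E(G) \ (bicircularMatroid G).closure X := by
  ext e
  refine ⟨fun hex ↦ ⟨Graph.Inc.edge_mem hex, fun hecl ↦ ?_⟩, fun ⟨he, hecl⟩ ↦ ?_⟩
  · exact hx ((hX.mem_closure_iff (Graph.Inc.edge_mem hex)).1 hecl x hex)
  · rw [hX.mem_closure_iff he] at hecl
    push Not at hecl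
    obtain ⟨y, hey, hy⟩ := hecl
    obtain rfl : y = x := (hV hey.vertex_mem).resolve_right hy
    exact hey

theorem exists_star_eq (hE : E(G).Finite) (hG' : NoIsolatedVertices G')
    (hM : bicircularMatroid G' = bicircularMatroid G) (hG : IsCactiGraph G) {x : α}
    (hx : x ∈ V(G)) (hGx : IsCactiGraph (G.deleteVerts {x})) :
    ∃ x' ∈ V(G'), star G' x' = star G x := by
  classical
  have hEE : E(G') = E(G) := congrArg Matroid.E hM
  have hle : G.deleteVerts {x} ≤ G := Graph.deleteVerts_le
  obtain ⟨F, hF⟩ := hE.exists_finset_coe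
  obtain ⟨X, hX⟩ := (hE.subset hle.edgeSet_mono).exists_finset_coe
  have hGF : edgeInduced G (F : Set β) = G := hF ▸ edgeInduced_edgeSet_of_le le_rfl hG.1
  have hGX : edgeInduced G (X : Set β) = G.deleteVerts {x} :=
    hX ▸ edgeInduced_edgeSet_of_le hle hGx.1
  have hV : (ends G F : Set α) = V(G) := coe_ends_of_le le_rfl hG.1 hF
  have hVx : (ends G X : Set α) = V(G) \ {x} := coe_ends_of_le hle hGx.1 hX
  have hV' : (ends G' F : Set α') = V(G') := coe_ends_of_le le_rfl hG' (hF.trans hEE.symm)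
  have hXE : (X : Set β) ⊆ E(G) := hX ▸ hle.edgeSet_mono
  rw [← hGF] at hG
  rw [← hGX] at hGx
  have hxX : x ∉ ends G X := fun h ↦ (hVx.subset h).2 rfl
  have hins : insert x (ends G X) = ends G F := by
    rw [← Finset.coe_inj, Finset.coe_insert, hVx, hV, Set.insert_sdiff_singleton,
      Set.insert_eq_of_mem hx]
  have hcard : #(ends G' X) + 1 = #(ends G' F) := by
    rw [hGx.card_ends_eq_of_bicircularMatroid_eq hM hXE,
      hG.card_ends_eq_of_bicircularMatroid_eq hM hF.le, ← hins, Finset.card_insert_of_notMem hxX]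
  obtain ⟨x', hx'X, hins'⟩ := Finset.exists_eq_insert_iff.2
    ⟨ends_mono G' (Finset.coe_subset.1 (hXE.trans hF.ge)), hcard⟩
  refine ⟨x', hV' ▸ hins' ▸ Finset.mem_insert_self x' _, ?_⟩
  rw [star_eq_edgeSet_sdiff_closure (hGx.noLeaves_of_bicircularMatroid_eq hM hXE) hx'X
      (by rw [← hV', ← hins', Finset.coe_insert]),
    star_eq_edgeSet_sdiff_closure hGx.2.1 hxX (by rw [← hV, ← hins, Finset.coe_insert]), hM, hEE]

theorem star_ne_star_of_noIsolatedVertices_deleteVerts {x y : α} (hy : y ∈ V(G)) (hxy : y ≠ x)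
    (hGx : NoIsolatedVertices (G.deleteVerts {x})) : star G x ≠ star G y := by
  intro hstar
  obtain ⟨e, he⟩ := hGx y (by rw [Graph.vertexSet_deleteVerts]; exact ⟨hy, hxy⟩)
  have hex : G.Inc e x := hstar.ge (he.mono Graph.deleteVerts_le)
  have hex' := (Graph.deleteVerts_le.inc_congr he.edge_mem).2 hex
  exact absurd hex'.vertex_mem (by simp)

theorem stronglyIsomorphic_of_star_eq (hE : E(G) = E(G')) (ν : V(G) ≃ V(G'))
    (hν : ∀ x, star G' (ν x) = star G x) : StronglyIsomorphic G G' := by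
  have hinc : ∀ (x : V(G)) e, G.Inc e x ↔ G'.Inc e (ν x) := fun x e ↦ (Set.ext_iff.1 (hν x) e).symm
  refine ⟨hE, ν, fun e x y ↦ ?_⟩
  rw [Graph.isLink_iff_inc, Graph.isLink_iff_inc, hinc, hinc]
  refine and_congr_right fun _ ↦ and_congr_right fun _ ↦ ⟨fun h z hz ↦ ?_, fun h z hz ↦ ?_⟩
  · obtain ⟨w, hw⟩ := ν.surjective ⟨z, hz.vertex_mem⟩
    obtain rfl : ν w = z := congrArg Subtype.val hw
    simpa only [Subtype.coe_inj, ν.apply_eq_iff_eq] using h w ((hinc w e).2 hz)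
  · have := h _ ((hinc ⟨z, hz.vertex_mem⟩ e).1 hz)
    simpa only [Subtype.coe_inj, ν.apply_eq_iff_eq, Subtype.ext_iff] using this

theorem vertexStars_eq_of_star_eq (ν : V(G) ≃ V(G')) (hν : ∀ x, star G' (ν x) = star G x) :
    vertexStars G = vertexStars G' := by
  ext S
  refine ⟨fun ⟨x, hx, hS⟩ ↦ ⟨ν ⟨x, hx⟩, (ν ⟨x, hx⟩).2, hS.trans (hν ⟨x, hx⟩).symm⟩,
    fun ⟨x', hx', hS⟩ ↦ ⟨ν.symm ⟨x', hx'⟩, (ν.symm ⟨x', hx'⟩).2, ?_⟩⟩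
  rw [hS, ← hν, ν.apply_symm_apply]

end KCircular

open KCircular in
theorem mainTheorem12_general {α α' β : Type*} {G : Graph α β} {G' : Graph α' β}
    (hE : E(G).Finite) (hG' : NoIsolatedVertices G') (hG : IsCactiGraph G)
    (hdel : ∀ x ∈ V(G), IsCactiGraph (G.deleteVerts {x}))
    (hM : bicircularMatroid G' = bicircularMatroid G) :
    vertexStars G = vertexStars G' ∧ StronglyIsomorphic G G' := by
  have hstar : ∀ x : V(G), ∃ x' : V(G'), star G' x' = star G x := fun x ↦ by
    obtain ⟨x', hx', h⟩ := exists_star_eq hE hG' hM hG x.2 (hdel x x.2)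
    exact ⟨⟨x', hx'⟩, h⟩
  choose ν hν using hstar
  have hinj : ν.Injective := fun x y hxy ↦ by
    by_contra hne
    exact star_ne_star_of_noIsolatedVertices_deleteVerts y.2 (fun h ↦ hne (Subtype.ext h.symm))
      (hdel x x.2).1 (by rw [← hν, ← hν, hxy])
  have hEE : E(G') = E(G) := congrArg Matroid.E hM
  have : Finite V(G') := finite_vertexSet_of_finite_edgeSet hG' (hEE ▸ hE)
  have hbij : ν.Bijective := hinj.bijective_of_nat_card_le
    (congrArg ENat.toNat (encard_vertexSet_eq_of_bicircularMatroid_eq hE hG' hM hG)).le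
  exact ⟨vertexStars_eq_of_star_eq (.ofBijective ν hbij) hν,
    stronglyIsomorphic_of_star_eq hEE.symm (.ofBijective ν hbij) hν⟩

theorem mainTheorem12 {α α' β : Type*} (G : Graph α β) (G' : Graph α' β)
    (hG : KCircular.IsFiniteGraph G) (hG' : KCircular.IsFiniteGraph G')
    (hiso : KCircular.NoIsolatedVertices G')
    (a1 : 1 ≤ KCircular.excess G ∧ KCircular.IsCactus G)
    (a2 : ∀ x ∈ V(G), 1 ≤ KCircular.excess (G.deleteVerts {x}) ∧
      KCircular.IsCactus (G.deleteVerts {x}))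
    (a3 : KCircular.kCircularMatroid G' 1 le_rfl = KCircular.kCircularMatroid G 1 le_rfl) :
    KCircular.vertexStars G = KCircular.vertexStars G' ∧ KCircular.StronglyIsomorphic G G' :=
  mainTheorem12_general hG.2 hiso a1.2.2 (fun x hx ↦ (a2 x hx).2.2) a3
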